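/- Let $X$ be a separable reflexive real Banach space. A cylinder measure $\mu$ on $X$ is a family of finite Radon measures $\mu_N$ on the quotients $X/N$, where $N$ ranges over the closed subspaces of $X$ of finite codimension, such that for $N\subseteq M$ the image of $\mu_N$ under the projection $X/N\to X/M$ is $\mu_M$. It is Gaussian if every $\mu_N$ is a Gaussian measure (centered or not, possibly degenerate). It admits a Radon extension if there is a finite Radon measure $\nu$ on $X$, for the norm topology, whose image under the projection $X\to X/N$ is $\mu_N$ for every $N$. For $\varphi:X\to[0,\infty]$, the integral $\int_X\varphi\,d\mu\in[0,\infty]$ is the supremum of $\int_{X/N} f\,d\mu_N$ over all $N$ and all bounded continuous $f:X/N\to[0,\infty)$ with $f(x+N)\le\varphi(x)$ for all $x\in X$. Let $\mu$ be a Gaussian cylinder measure on $X$ and let $0<p<\infty$. Then $\mu$ admits a Radon extension if and only if $$\int_X\|x\|^p\,d\mu(x)<\infty .$$ -/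

import Mathlib

open MeasureTheory ProbabilityTheory
open scoped ENNReal NNReal BoundedContinuousFunction

noncomputable section

/-- A finite Radon measure: a finite Borel measure which is inner regular with respect to
compact sets. -/
structure IsFiniteRadon {E : Type*} [TopologicalSpace E] [MeasurableSpace E] (μ : Measure E) :
    Prop where
  finite : IsFiniteMeasure μ
  innerRegular : μ.InnerRegular

/-- An index for the coordinate system of all finite-dimensional quotients of the normed space
`X`: a closed subspace `N` of finite codimension (equivalently, the kernel of a continuous linear
map `X → ℝⁿ`). -/
structure FinCodimSubspace (X : Type*) [NormedAddCommGroup X] [NormedSpace ℝ X] where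
  toSubmodule : Submodule ℝ X
  isClosed : IsClosed (toSubmodule : Set X)
  finiteDimensional : FiniteDimensional ℝ (X ⧸ toSubmodule)

namespace FinCodimSubspace

variable {X : Type*} [NormedAddCommGroup X] [NormedSpace ℝ X]

/-- The quotient space `X ⧸ N`, with the quotient topology (which is given by the quotient norm)
and its Borel σ-algebra. -/
def Quot (N : FinCodimSubspace X) : Type _ := X ⧸ N.toSubmodule

instance (N : FinCodimSubspace X) : NormedAddCommGroup N.Quot :=
  Submodule.Quotient.normedAddCommGroup N.toSubmodule (hS := N.isClosed)

instance (N : FinCodimSubspace X) : NormedSpace ℝ N.Quot :=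
  Submodule.Quotient.normedSpace N.toSubmodule ℝ

instance (N : FinCodimSubspace X) : FiniteDimensional ℝ N.Quot := N.finiteDimensional

instance (N : FinCodimSubspace X) : MeasurableSpace N.Quot := borel N.Quot

instance (N : FinCodimSubspace X) : BorelSpace N.Quot := ⟨rfl⟩

/-- The canonical projection `X → X ⧸ N`. -/
def proj (N : FinCodimSubspace X) : X →ₗ[ℝ] N.Quot := N.toSubmodule.mkQ

/-- The canonical projection `X ⧸ N → X ⧸ M`, when `N ⊆ M`. -/
def transition {N M : FinCodimSubspace X} (h : N.toSubmodule ≤ M.toSubmodule) :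
    N.Quot →ₗ[ℝ] M.Quot := Submodule.factor h

end FinCodimSubspace

/-- A cylinder measure on `X`, for the coordinate system of all finite-dimensional quotients:
a family of (finite) Radon measures on the quotients `X ⧸ N`, compatible with the projections
`X ⧸ N → X ⧸ M`. -/
structure CylinderMeasure (X : Type*) [NormedAddCommGroup X] [NormedSpace ℝ X] where
  marginal : ∀ N : FinCodimSubspace X, Measure N.Quot
  isFiniteRadon : ∀ N, IsFiniteRadon (marginal N)
  compatible : ∀ (N M : FinCodimSubspace X) (h : N.toSubmodule ≤ M.toSubmodule),
    (marginal N).map (FinCodimSubspace.transition h) = marginal M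

namespace CylinderMeasure

variable {X : Type*} [NormedAddCommGroup X] [NormedSpace ℝ X]

/-- A cylinder measure is Gaussian if all its finite-dimensional marginals are Gaussian measures
(centered or not, possibly degenerate). -/
def IsGaussian (μ : CylinderMeasure X) : Prop :=
  ∀ N : FinCodimSubspace X, ProbabilityTheory.IsGaussian (μ.marginal N)

/-- The integral of a function `φ : X → [0, ∞]` with respect to a cylinder measure: the supremum
of the integrals of the nonnegative cylinder functions `x ↦ f (N.proj x)`, with `f` bounded and
continuous on `X ⧸ N`, which lie below `φ`. -/
def lintegral (μ : CylinderMeasure X) (φ : X → ℝ≥0∞) : ℝ≥0∞ :=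
  ⨆ (N : FinCodimSubspace X) (f : N.Quot →ᵇ ℝ≥0) (_ : ∀ x : X, (f (N.proj x) : ℝ≥0∞) ≤ φ x),
    ∫⁻ y, (f y : ℝ≥0∞) ∂(μ.marginal N)

/-- A cylinder measure admits a Radon extension if its marginals are the images of one Radon
measure on `X` (for the norm topology). -/
def HasRadonExtension [MeasurableSpace X] [BorelSpace X] (μ : CylinderMeasure X) : Prop :=
  ∃ ν : Measure X, IsFiniteRadon ν ∧ ∀ N : FinCodimSubspace X, ν.map N.proj = μ.marginal N

end CylinderMeasure

/-- A real normed space is reflexive if the canonical map into its bidual is onto. -/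
def IsReflexiveSpace (X : Type*) [NormedAddCommGroup X] [NormedSpace ℝ X] : Prop :=
  Function.Surjective (NormedSpace.inclusionInDoubleDual ℝ X)

end

/-!
A Radon extension `ν` of a Gaussian cylinder measure is a Gaussian measure, since every continuous
functional factors through a finite-dimensional quotient. By Fernique's theorem `‖x‖ ^ p` is
`ν`-integrable, and this integral dominates the integral with respect to the cylinder measure.

Conversely, a finite `p`-th moment bounds the tails of all quotient norms uniformly, by Markov's
inequality (`marginal_norm_gt_le`); this is the only way the moment is used, and Gaussianity only
enters through the marginals being probability measures. For a countable family `ℓ` of functionals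
the tail bounds make the finite-dimensional laws tight on `ι → ℝ`, so Prokhorov's theorem provides
their projective limit `P` (`exists_isProjectiveLimit`). A point of `ι → ℝ` all of whose finite
subfamilies of coordinates come from a fixed ball of `X` comes itself from that ball, because balls
of a reflexive space are weakly compact (`exists_forall_apply_eq`). Hence `P` is carried by the
image of `x ↦ (ℓ i x)` (`measure_compl_range_eq_zero`). If `ℓ` separates points, this map is an
injective continuous map on a Polish space, thus a measurable embedding by the Lusin-Souslin
theorem, and `P` pulls back to a measure `ν` on `X`, which is Radon since `X` is Polish.

The measure `ν` has the right law along every functional `g`, not only along those in `ℓ`: the same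
construction for `ℓ` enlarged by `g` yields a measure with the same coordinates along `ℓ`, hence the
same measure (`exists_measure_map_eq_law`). Characteristic functions then identify the image of `ν`
in every `X ⧸ N`.
-/

noncomputable section

open Filter Topology Metric Set TopologicalSpace

variable {X : Type*} [NormedAddCommGroup X] [NormedSpace ℝ X]

/-! ### Finite-dimensional quotients -/

namespace FinCodimSubspace

lemma proj_surjective (N : FinCodimSubspace X) : Function.Surjective N.proj :=
  N.toSubmodule.mkQ_surjective

lemma norm_proj_le (N : FinCodimSubspace X) (x : X) : ‖N.proj x‖ ≤ ‖x‖ :=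
  Submodule.Quotient.norm_mk_le N.toSubmodule x

/-- The projection `X → X ⧸ N` as a continuous linear map. -/
def projL (N : FinCodimSubspace X) : X →L[ℝ] N.Quot :=
  N.proj.mkContinuous 1 fun x => by simpa using N.norm_proj_le x

@[simp] lemma projL_apply (N : FinCodimSubspace X) (x : X) : N.projL x = N.proj x := rfl

lemma exists_proj_eq_norm_lt (N : FinCodimSubspace X) (y : N.Quot) {R : ℝ} (h : ‖y‖ < R) :
    ∃ x : X, N.proj x = y ∧ ‖x‖ < R := by
  obtain ⟨x, hx, hxR⟩ := Submodule.Quotient.norm_mk_lt (S := N.toSubmodule) y (sub_pos.2 h)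
  exact ⟨x, hx, hxR.trans_eq (add_sub_cancel ‖y‖ R)⟩

/-- The kernel of a continuous linear map with values in a finite-dimensional space. -/
def ker {F : Type*} [NormedAddCommGroup F] [NormedSpace ℝ F] [FiniteDimensional ℝ F]
    (L : X →L[ℝ] F) : FinCodimSubspace X where
  toSubmodule := LinearMap.ker (L : X →ₗ[ℝ] F)
  isClosed := L.isClosed_ker
  finiteDimensional := (L : X →ₗ[ℝ] F).quotKerEquivRange.symm.finiteDimensional

variable {F : Type*} [NormedAddCommGroup F] [NormedSpace ℝ F] [FiniteDimensional ℝ F]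

/-- The factorization through `X ⧸ N` of a continuous linear map vanishing on `N`. -/
def lift (N : FinCodimSubspace X) (L : X →L[ℝ] F)
    (h : N.toSubmodule ≤ (ker L).toSubmodule) : N.Quot →L[ℝ] F :=
  LinearMap.toContinuousLinearMap
    (N.toSubmodule.liftQ (L : X →ₗ[ℝ] F) h : N.Quot →ₗ[ℝ] F)

@[simp] lemma lift_proj (N : FinCodimSubspace X) (L : X →L[ℝ] F)
    (h : N.toSubmodule ≤ (ker L).toSubmodule) (x : X) : N.lift L h (N.proj x) = L x := rfl

end FinCodimSubspace

/-! ### Finite-dimensional laws of a cylinder measure -/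

namespace CylinderMeasure

open FinCodimSubspace

variable {F G : Type*} [NormedAddCommGroup F] [NormedSpace ℝ F] [FiniteDimensional ℝ F]
  [MeasurableSpace F] [BorelSpace F]
  [NormedAddCommGroup G] [NormedSpace ℝ G] [FiniteDimensional ℝ G]
  [MeasurableSpace G] [BorelSpace G]

/-- The image of a cylinder measure under a continuous linear map `L : X → F` of finite rank,
read off from the marginal on `X ⧸ ker L`. -/
def law (μ : CylinderMeasure X) (L : X →L[ℝ] F) : Measure F :=
  (μ.marginal (ker L)).map ((ker L).lift L le_rfl)

lemma map_lift_marginal (μ : CylinderMeasure X) (N : FinCodimSubspace X) (L : X →L[ℝ] F)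
    (h : N.toSubmodule ≤ (ker L).toSubmodule) :
    (μ.marginal N).map (N.lift L h) = μ.law L := by
  have ht : Measurable (transition h) :=
    (LinearMap.continuous_of_finiteDimensional (transition h)).measurable
  rw [law, ← μ.compatible N (ker L) h, Measure.map_map (by fun_prop) ht]
  congr 1
  ext y
  obtain ⟨x, rfl⟩ := N.proj_surjective y
  rfl

lemma map_marginal (μ : CylinderMeasure X) (N : FinCodimSubspace X) (A : N.Quot →L[ℝ] F) :
    (μ.marginal N).map A = μ.law (A ∘L N.projL) := by
  have h : N.toSubmodule ≤ (ker (A ∘L N.projL)).toSubmodule := by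
    intro x hx
    have : N.proj x = 0 := (Submodule.Quotient.mk_eq_zero _).2 hx
    change A (N.proj x) = 0
    rw [this, map_zero]
  rw [← μ.map_lift_marginal N _ h]
  congr 1
  ext y
  obtain ⟨x, rfl⟩ := N.proj_surjective y
  rfl

lemma map_law (μ : CylinderMeasure X) (L : X →L[ℝ] F) (A : F →L[ℝ] G) :
    (μ.law L).map A = μ.law (A ∘L L) := by
  rw [law, Measure.map_map (by fun_prop) (by fun_prop), ← ContinuousLinearMap.coe_comp,
    map_marginal]
  rfl

lemma isProbabilityMeasure_law (μ : CylinderMeasure X)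
    (hμ : ∀ N, IsProbabilityMeasure (μ.marginal N)) (L : X →L[ℝ] F) :
    IsProbabilityMeasure (μ.law L) :=
  Measure.isProbabilityMeasure_map (by fun_prop)

/-- Balls of `X` and of its quotients correspond up to enlarging the radius, whence the passage
from `R` to `R + 1`. -/
lemma law_compl_image_closedBall_le (μ : CylinderMeasure X) (L : X →L[ℝ] F) (R : ℝ) :
    μ.law L (L '' closedBall 0 (R + 1))ᶜ ≤ μ.marginal (ker L) {y | R < ‖y‖} := by
  set A := (ker L).lift L le_rfl with hA
  have hinj : Function.Injective A := by
    rw [injective_iff_map_eq_zero]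
    intro y hy
    obtain ⟨x, rfl⟩ := (ker L).proj_surjective y
    exact (Submodule.Quotient.mk_eq_zero _).2 hy
  have : ProperSpace (ker L).Quot := FiniteDimensional.proper ℝ _
  have hK : IsCompact (A '' closedBall 0 R) :=
    (isCompact_closedBall 0 R).image A.continuous
  have hsub : A '' closedBall 0 R ⊆ L '' closedBall 0 (R + 1) := by
    rintro _ ⟨y, hy, rfl⟩
    obtain ⟨x, rfl, hx⟩ := (ker L).exists_proj_eq_norm_lt y
      (show ‖y‖ < R + 1 by rw [mem_closedBall_zero_iff] at hy; linarith)
    exact ⟨x, by simpa using hx.le, rfl⟩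
  calc μ.law L (L '' closedBall 0 (R + 1))ᶜ
      ≤ μ.law L (A '' closedBall 0 R)ᶜ := measure_mono (compl_subset_compl.2 hsub)
    _ = μ.marginal (ker L) (A ⁻¹' (A '' closedBall 0 R)ᶜ) :=
        Measure.map_apply (by fun_prop) hK.measurableSet.compl
    _ = μ.marginal (ker L) {y | R < ‖y‖} := by
        rw [preimage_compl, hinj.preimage_image]
        congr 1
        ext y
        simp

/-- Markov's inequality for the quotient norms, uniformly in the marginals: the test function
`y ↦ min ‖y‖ R ^ p` on `X ⧸ N` is admissible in the integral of `‖x‖ ^ p`. -/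
lemma marginal_norm_gt_le (μ : CylinderMeasure X) {p : ℝ} (hp : 0 < p) {R : ℝ≥0} (hR : 0 < R)
    (N : FinCodimSubspace X) :
    μ.marginal N {y | R < ‖y‖} ≤ μ.lintegral (fun x => ‖x‖ₑ ^ p) / (R : ℝ≥0∞) ^ p := by
  have hcont : Continuous fun y : N.Quot => min ‖y‖₊ R ^ p :=
    (NNReal.continuous_rpow_const hp.le).comp (continuous_nnnorm.min continuous_const)
  have hle (y : N.Quot) : min ‖y‖₊ R ^ p ≤ R ^ p :=
    NNReal.rpow_le_rpow (min_le_right _ _) hp.le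
  let f : N.Quot →ᵇ ℝ≥0 := BoundedContinuousFunction.mkOfBound ⟨_, hcont⟩ (R ^ p : ℝ≥0)
    fun y z => by
      rw [NNReal.dist_eq]
      exact abs_sub_le_of_nonneg_of_le (NNReal.coe_nonneg _) (hle y) (NNReal.coe_nonneg _) (hle z)
  have hf (y : N.Quot) : (f y : ℝ≥0∞) = (min ‖y‖₊ R : ℝ≥0) ^ p :=
    (ENNReal.coe_rpow_of_nonneg _ hp.le)
  have hfle (x : X) : (f (N.proj x) : ℝ≥0∞) ≤ ‖x‖ₑ ^ p := by
    rw [hf]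
    refine ENNReal.rpow_le_rpow (ENNReal.coe_le_coe.2 ((min_le_left _ _).trans ?_)) hp.le
    exact N.norm_proj_le x
  have hR0 : (R : ℝ≥0∞) ^ p ≠ 0 :=
    (ENNReal.rpow_pos (ENNReal.coe_pos.2 hR) ENNReal.coe_ne_top).ne'
  have hRtop : (R : ℝ≥0∞) ^ p ≠ ∞ := ENNReal.rpow_ne_top_of_nonneg hp.le ENNReal.coe_ne_top
  calc μ.marginal N {y | R < ‖y‖}
      ≤ μ.marginal N {y | (R : ℝ≥0∞) ^ p ≤ f y} := by
        refine measure_mono fun y (hy : (R : ℝ) < ‖y‖) => ?_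
        rw [mem_ofPred_eq, hf, min_eq_right (show R ≤ ‖y‖₊ from hy.le)]
    _ ≤ (∫⁻ y, f y ∂μ.marginal N) / (R : ℝ≥0∞) ^ p :=
        meas_ge_le_lintegral_div (f.continuous.measurable.coe_nnreal_ennreal.aemeasurable)
          hR0 hRtop
    _ ≤ μ.lintegral (fun x => ‖x‖ₑ ^ p) / (R : ℝ≥0∞) ^ p := by
        gcongr
        exact le_iSup_of_le N (le_iSup_of_le f (le_iSup_of_le hfle le_rfl))

end CylinderMeasure

/-! ### Projective limits along countable families of functionals -/

/-- The map `x ↦ (ℓ i x)_{i ∈ J}` attached to a finite subfamily of a family of functionals. -/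
def finiteCoords {ι : Type*} (ℓ : ι → X →L[ℝ] ℝ) (J : Finset ι) : X →L[ℝ] (J → ℝ) :=
  ContinuousLinearMap.pi fun j : J => ℓ j

@[simp] lemma finiteCoords_apply {ι : Type*} (ℓ : ι → X →L[ℝ] ℝ) (J : Finset ι) (x : X) (j : J) :
    finiteCoords ℓ J x j = ℓ j x := rfl

/-- In a reflexive space, bounded solvability of every finite subsystem of `ℓ i x = a i` implies
solvability of the whole system with the same bound, by weak compactness of balls. -/
lemma exists_forall_apply_eq (hX : IsReflexiveSpace X) {ι : Type*} (ℓ : ι → X →L[ℝ] ℝ)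
    (a : ι → ℝ) {R : ℝ} (h : ∀ J : Finset ι, ∃ x : X, ‖x‖ ≤ R ∧ ∀ i ∈ J, ℓ i x = a i) :
    ∃ x : X, ‖x‖ ≤ R ∧ ∀ i, ℓ i x = a i := by
  choose x hxR hx using h
  let Jx : Finset ι → WeakDual ℝ (StrongDual ℝ X) := fun J =>
    StrongDual.toWeakDual (NormedSpace.inclusionInDoubleDual ℝ X (x J))
  have hmem (J : Finset ι) :
      Jx J ∈ WeakDual.toStrongDual ⁻¹' closedBall (0 : StrongDual ℝ (StrongDual ℝ X)) R := by
    have h : ‖NormedSpace.inclusionInDoubleDual ℝ X (x J)‖ ≤ R :=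
      (NormedSpace.double_dual_bound ℝ X (x J)).trans (hxR J)
    exact (dist_zero_right (NormedSpace.inclusionInDoubleDual ℝ X (x J))).trans_le h
  -- A weak-* cluster point in the bidual of the solutions of the finite subsystems; by reflexivity
  -- it is a point of `X`.
  obtain ⟨ψ, hψR, hψ⟩ := (WeakDual.isCompact_closedBall (0 : StrongDual ℝ (StrongDual ℝ X)) R)
    (f := map Jx atTop) (le_principal_iff.2 (mem_map.2 (Eventually.of_forall hmem)))
  obtain ⟨z, hz⟩ := hX (WeakDual.toStrongDual ψ)
  have hzψ (f : StrongDual ℝ X) : f z = ψ f := by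
    rw [← NormedSpace.dual_def ℝ X z f, hz]; rfl
  refine ⟨z, ?_, fun i => ?_⟩
  · rw [← (NormedSpace.inclusionInDoubleDualLi ℝ (E := X)).norm_map z]
    change ‖NormedSpace.inclusionInDoubleDual ℝ X z‖ ≤ R
    rw [hz]
    simpa using hψR
  · have hc : ClusterPt (ψ (ℓ i)) (map (fun J => Jx J (ℓ i)) atTop) :=
      hψ.map (WeakDual.eval_continuous (ℓ i)).continuousAt tendsto_map
    have hev : Tendsto (fun J => Jx J (ℓ i)) atTop (𝓝 (a i)) := by
      refine tendsto_const_nhds.congr' ?_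
      filter_upwards [eventually_ge_atTop {i}] with J hJ
      exact (hx J i (Finset.singleton_subset_iff.1 hJ)).symm
    rw [hzψ]
    by_contra hne
    exact (hc.mono hev).ne (disjoint_iff.1 (disjoint_nhds_nhds.2 hne))

namespace CylinderMeasure

variable {μ : CylinderMeasure X} {ι : Type*} {u : ℕ → ℝ≥0}

lemma law_compl_image_closedBall_le_of_tail {F : Type*} [NormedAddCommGroup F] [NormedSpace ℝ F]
    [FiniteDimensional ℝ F] [MeasurableSpace F] [BorelSpace F]
    (hu : ∀ (n : ℕ) N, μ.marginal N {y | (n : ℝ) < ‖y‖} ≤ u n) (L : X →L[ℝ] F) (n : ℕ) :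
    μ.law L (L '' closedBall 0 (n + 1))ᶜ ≤ u n :=
  (μ.law_compl_image_closedBall_le L n).trans (hu n _)

/-- As `J` grows, the laws of `(ℓ i)_{i ∈ J}`, extended by zero to all coordinates, form a tight
net of probability measures on `ι → ℝ`; any cluster point is a projective limit. -/
lemma exists_isProjectiveLimit [Countable ι] (hμ : ∀ N, IsProbabilityMeasure (μ.marginal N))
    (hu0 : Tendsto u atTop (𝓝 0))
    (hu : ∀ (n : ℕ) N, μ.marginal N {y | (n : ℝ) < ‖y‖} ≤ u n) (ℓ : ι → X →L[ℝ] ℝ) :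
    ∃ P : Measure (ι → ℝ), IsProbabilityMeasure P ∧
      IsProjectiveLimit P fun J => μ.law (finiteCoords ℓ J) := by
  classical
  let E : ∀ J : Finset ι, (J → ℝ) → ι → ℝ := fun J v i => if h : i ∈ J then v ⟨i, h⟩ else 0
  have hE (J : Finset ι) : Continuous (E J) := by
    refine continuous_pi fun i => ?_
    by_cases h : i ∈ J
    · simpa [E, h] using continuous_apply (⟨i, h⟩ : J)
    · simpa [E, h] using continuous_const
  have hp (J : Finset ι) : IsProbabilityMeasure (μ.law (finiteCoords ℓ J)) :=
    μ.isProbabilityMeasure_law hμ _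
  let P : Finset ι → ProbabilityMeasure (ι → ℝ) := fun J =>
    ⟨(μ.law (finiteCoords ℓ J)).map (E J), Measure.isProbabilityMeasure_map (hE J).aemeasurable⟩
  -- The coordinates of a vector of norm at most `n + 1` lie in this box.
  let K : ℕ → Set (ι → ℝ) := fun n => univ.pi fun i => closedBall 0 (‖ℓ i‖ * (n + 1))
  have hK (n : ℕ) : IsCompact (K n) := isCompact_univ_pi fun i => isCompact_closedBall _ _
  have hKmono : Monotone K := by
    intro m n hmn
    refine pi_mono fun i _ => closedBall_subset_closedBall ?_
    gcongr
  have hPK (J : Finset ι) (n : ℕ) : P J (K n)ᶜ ≤ u n := by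
    rw [← ENNReal.coe_le_coe, ProbabilityMeasure.ennreal_coeFn_eq_coeFn_toMeasure]
    change (μ.law (finiteCoords ℓ J)).map (E J) (K n)ᶜ ≤ u n
    rw [Measure.map_apply (hE J).measurable (hK n).measurableSet.compl]
    refine (measure_mono ?_).trans
      (law_compl_image_closedBall_le_of_tail hu (finiteCoords ℓ J) n)
    rw [preimage_compl, compl_subset_compl]
    rintro _ ⟨x, hx, rfl⟩ i -
    rw [mem_closedBall_zero_iff] at hx ⊢
    by_cases h : i ∈ J
    · simpa [E, h] using (ℓ i).le_of_opNorm_le_of_le le_rfl hx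
    · simp only [E, h, dite_false, norm_zero]
      positivity
  have hcpt := isCompact_setOfPred_probabilityMeasure_mass_eq_compl_isCompact_le hu0 hK
    (Or.inr hKmono)
  let U : Ultrafilter (Finset ι) := Ultrafilter.of atTop
  have hU : (U : Filter (Finset ι)) ≤ atTop := Ultrafilter.of_le _
  obtain ⟨Q, -, hQ⟩ := hcpt.ultrafilter_le_nhds (U.map P)
    (le_principal_iff.2 (mem_map.2 (Eventually.of_forall fun J => hPK J)))
  refine ⟨Q, inferInstance, fun I => ?_⟩
  have hI : Continuous (I.restrict (π := fun _ : ι => ℝ)) := by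
    exact continuous_pi fun i => continuous_apply _
  have hlim : Tendsto (fun J => (P J).map hI.aemeasurable) U (𝓝 (Q.map hI.aemeasurable)) :=
    ((ProbabilityMeasure.continuous_map hI).tendsto Q).comp hQ
  let PI : ProbabilityMeasure (I → ℝ) := ⟨μ.law (finiteCoords ℓ I), hp I⟩
  have hconst : Tendsto (fun J => (P J).map hI.aemeasurable) U (𝓝 PI) := by
    refine tendsto_const_nhds.congr' ?_
    -- For `J ⊇ I` the extension by zero does not touch the coordinates in `I`.
    filter_upwards [hU (eventually_ge_atTop I)] with J (hJ : I ⊆ J)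
    let A : (J → ℝ) →L[ℝ] (I → ℝ) :=
      ContinuousLinearMap.pi fun i => ContinuousLinearMap.proj (⟨i, hJ i.2⟩ : J)
    apply Subtype.ext
    change μ.law (A ∘L finiteCoords ℓ J) = ((μ.law (finiteCoords ℓ J)).map (E J)).map I.restrict
    rw [← map_law, Measure.map_map hI.measurable (hE J).measurable]
    congr 1
    ext v i
    simp [E, A, hJ i.2]
  have hQI : Q.map hI.aemeasurable = PI := tendsto_nhds_unique hlim hconst
  exact congrArg Subtype.val hQI

end CylinderMeasure

/-! ### Consequences of a Radon extension -/

namespace CylinderMeasure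

variable {μ : CylinderMeasure X} [MeasurableSpace X] [BorelSpace X]

lemma lintegral_le_of_map_proj_eq {ν : Measure X} (hν : ∀ N, ν.map N.proj = μ.marginal N)
    (φ : X → ℝ≥0∞) : μ.lintegral φ ≤ ∫⁻ x, φ x ∂ν := by
  refine iSup_le fun N => iSup_le fun f => iSup_le fun hf => ?_
  have hN : Measurable N.proj := N.projL.continuous.measurable
  rw [← hν N, lintegral_map f.continuous.measurable.coe_nnreal_ennreal hN]
  exact lintegral_mono hf

lemma isGaussian_of_map_proj_eq (hμ : μ.IsGaussian) {ν : Measure X}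
    (hν : ∀ N, ν.map N.proj = μ.marginal N) : ProbabilityTheory.IsGaussian ν := by
  refine isGaussian_of_isGaussian_map fun L => ?_
  have hN : Measurable (FinCodimSubspace.ker L).proj :=
    (FinCodimSubspace.ker L).projL.continuous.measurable
  have h : ν.map L = μ.law L := by
    rw [law, ← hν, Measure.map_map (by fun_prop) hN]
    rfl
  have := hμ (FinCodimSubspace.ker L)
  rw [h, law]
  infer_instance

end CylinderMeasure

/-! ### Concentration on the image of `X` -/

/-- Norming functionals for a dense sequence separate the points of a separable normed space. -/
lemma exists_seq_separating_functionals (X : Type*) [NormedAddCommGroup X] [NormedSpace ℝ X]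
    [SeparableSpace X] : ∃ ℓ : ℕ → X →L[ℝ] ℝ, ∀ x, (∀ n, ℓ n x = 0) → x = 0 := by
  choose g hg1 hg using fun n => exists_dual_vector'' ℝ (denseSeq X n)
  refine ⟨g, fun x hx => norm_le_zero_iff.1 (le_of_forall_pos_le_add fun ε hε => ?_)⟩
  obtain ⟨n, hn⟩ := (denseRange_denseSeq X).exists_dist_lt x (half_pos hε)
  rw [dist_eq_norm] at hn
  have h1 : ‖denseSeq X n‖ ≤ ‖x - denseSeq X n‖ := by
    calc ‖denseSeq X n‖ = g n (denseSeq X n) := (hg n).symm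
      _ = - g n (x - denseSeq X n) := by rw [map_sub, hx n]; ring
      _ ≤ ‖g n (x - denseSeq X n)‖ := neg_le_abs _
      _ ≤ 1 * ‖x - denseSeq X n‖ := (g n).le_of_opNorm_le (hg1 n) _
      _ = ‖x - denseSeq X n‖ := one_mul _
  have h2 : ‖x‖ ≤ ‖x - denseSeq X n‖ + ‖denseSeq X n‖ := norm_le_norm_sub_add _ _
  linarith

namespace CylinderMeasure

variable {μ : CylinderMeasure X} {ι : Type*} {ℓ : ι → X →L[ℝ] ℝ} {u : ℕ → ℝ≥0}

/-- Outside the coordinate image of the ball of radius `n + 1`, some finite subsystem of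
`ℓ i x = a i` already has no solution in that ball, so the finite-dimensional tail bounds pass to
the projective limit. -/
lemma measure_compl_range_eq_zero [Countable ι] (hX : IsReflexiveSpace X)
    (hu0 : Tendsto u atTop (𝓝 0))
    (hu : ∀ (n : ℕ) N, μ.marginal N {y | (n : ℝ) < ‖y‖} ≤ u n) {P : Measure (ι → ℝ)}
    (hP : IsProjectiveLimit P fun J => μ.law (finiteCoords ℓ J)) :
    P (range fun (x : X) i => ℓ i x)ᶜ = 0 := by
  classical
  let S : ℕ → Finset ι → Set (ι → ℝ) := fun n J =>
    J.restrict ⁻¹' (finiteCoords ℓ J '' closedBall 0 (n + 1))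
  have hS (n : ℕ) (J : Finset ι) : P (S n J)ᶜ ≤ u n := by
    calc P (S n J)ᶜ ≤ P.map J.restrict (finiteCoords ℓ J '' closedBall 0 (n + 1))ᶜ :=
          Measure.le_map_apply (by fun_prop) _
      _ = μ.law (finiteCoords ℓ J) (finiteCoords ℓ J '' closedBall 0 (n + 1))ᶜ := by rw [hP J]
      _ ≤ u n := law_compl_image_closedBall_le_of_tail hu _ n
  have hanti (n : ℕ) : Monotone fun J => (S n J)ᶜ := by
    intro I J hIJ
    refine compl_subset_compl.2 ?_
    rintro a ⟨x, hx, hxa⟩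
    refine ⟨x, hx, ?_⟩
    ext i
    exact congrFun hxa ⟨i, hIJ i.2⟩
  have hle (n : ℕ) : P (range fun (x : X) i => ℓ i x)ᶜ ≤ u n := by
    calc P (range fun (x : X) i => ℓ i x)ᶜ ≤ P (⋃ J, (S n J)ᶜ) := by
          refine measure_mono ?_
          rw [← compl_iInter, compl_subset_compl]
          intro a ha
          obtain ⟨x, -, hx⟩ := exists_forall_apply_eq hX ℓ a (R := n + 1) fun J => by
            obtain ⟨x, hx, hxa⟩ := mem_iInter.1 ha J
            exact ⟨x, mem_closedBall_zero_iff.1 hx, fun i hi => congrFun hxa ⟨i, hi⟩⟩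
          exact ⟨x, funext hx⟩
      _ = ⨆ J, P (S n J)ᶜ := (hanti n).directed_le.measure_iUnion
      _ ≤ u n := iSup_le fun J => hS n J
  have hlim : Tendsto (fun n => (u n : ℝ≥0∞)) atTop (𝓝 0) := by
    simpa using ENNReal.tendsto_coe.2 hu0
  exact le_antisymm (ge_of_tendsto' hlim hle) zero_le

variable [MeasurableSpace X] [BorelSpace X] [CompleteSpace X] [SeparableSpace X]

/-- An instance of the Lusin-Souslin theorem. -/
lemma measurableEmbedding_coords [Countable ι] (hℓ : ∀ x, (∀ i, ℓ i x = 0) → x = 0) :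
    MeasurableEmbedding fun (x : X) i => ℓ i x := by
  have : SecondCountableTopology X := UniformSpace.secondCountable_of_separable X
  refine Continuous.measurableEmbedding (by fun_prop) fun x y hxy => ?_
  refine sub_eq_zero.1 (hℓ _ fun i => ?_)
  rw [map_sub, sub_eq_zero]
  exact congrFun hxy i

/-- The projective limit on `ι → ℝ` is carried by the image of `X`, hence pulls back to `X`. -/
lemma exists_measure_map_finiteCoords_eq [Countable ι] (hX : IsReflexiveSpace X)
    (hμ : ∀ N, IsProbabilityMeasure (μ.marginal N)) (hu0 : Tendsto u atTop (𝓝 0))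
    (hu : ∀ (n : ℕ) N, μ.marginal N {y | (n : ℝ) < ‖y‖} ≤ u n)
    (hℓ : ∀ x, (∀ i, ℓ i x = 0) → x = 0) :
    ∃ ν : Measure X, IsProbabilityMeasure ν ∧
      ∀ J : Finset ι, ν.map (finiteCoords ℓ J) = μ.law (finiteCoords ℓ J) := by
  obtain ⟨P, hP1, hP⟩ := exists_isProjectiveLimit hμ hu0 hu ℓ
  have hT := measurableEmbedding_coords hℓ
  have hmap : (P.comap fun (x : X) i => ℓ i x).map (fun (x : X) i => ℓ i x) = P := by
    rw [hT.map_comap]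
    exact Measure.restrict_eq_self_of_ae_mem
      (mem_ae_iff.2 (measure_compl_range_eq_zero hX hu0 hu hP))
  refine ⟨P.comap fun (x : X) i => ℓ i x, ?_, fun J => ?_⟩
  · refine (Measure.isProbabilityMeasure_map_iff hT.measurable.aemeasurable).1 ?_
    rwa [hmap]
  · have hJ : P.map J.restrict = μ.law (finiteCoords ℓ J) := hP J
    rw [← hmap, Measure.map_map (by fun_prop) hT.measurable] at hJ
    exact hJ

lemma eq_of_map_finiteCoords_eq [Countable ι] (hℓ : ∀ x, (∀ i, ℓ i x = 0) → x = 0)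
    {ν ν' : Measure X} [IsFiniteMeasure ν] [IsFiniteMeasure ν']
    (h : ∀ J : Finset ι, ν.map (finiteCoords ℓ J) = ν'.map (finiteCoords ℓ J)) : ν = ν' := by
  have hT := measurableEmbedding_coords hℓ
  have hproj (ρ : Measure X) : IsProjectiveLimit (ρ.map fun (x : X) i => ℓ i x)
      fun J => ρ.map (finiteCoords ℓ J) := fun J => by
    rw [Measure.map_map (by fun_prop) hT.measurable]
    rfl
  have := (hproj ν).unique (funext h ▸ hproj ν')
  rw [← hT.comap_map ν, this, hT.comap_map]

/-- The law along a functional `g` is realized by a measure `ν'` built from the family `ℓ`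
enlarged by `g`; as `ν'` has the same coordinates along `ℓ` as `ν`, the two coincide. -/
lemma exists_measure_map_eq_law (hX : IsReflexiveSpace X)
    (hμ : ∀ N, IsProbabilityMeasure (μ.marginal N)) (hu0 : Tendsto u atTop (𝓝 0))
    (hu : ∀ (n : ℕ) N, μ.marginal N {y | (n : ℝ) < ‖y‖} ≤ u n) :
    ∃ ν : Measure X, IsProbabilityMeasure ν ∧ ∀ g : X →L[ℝ] ℝ, ν.map g = μ.law g := by
  obtain ⟨ℓ, hℓ⟩ := exists_seq_separating_functionals X
  obtain ⟨ν, hν1, hν⟩ := exists_measure_map_finiteCoords_eq hX hμ hu0 hu hℓ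
  refine ⟨ν, hν1, fun g => ?_⟩
  let ℓ' : Option ℕ → X →L[ℝ] ℝ := fun o => o.elim g ℓ
  have hℓ' : ∀ x, (∀ o, ℓ' o x = 0) → x = 0 := fun x hx => hℓ x fun n => hx (some n)
  obtain ⟨ν', hν'1, hν'⟩ := exists_measure_map_finiteCoords_eq hX hμ hu0 hu hℓ'
  have key {F : Type} [NormedAddCommGroup F] [NormedSpace ℝ F] [FiniteDimensional ℝ F]
      [MeasurableSpace F] [BorelSpace F] (J : Finset (Option ℕ)) (A : (J → ℝ) →L[ℝ] F) :
      ν'.map (A ∘L finiteCoords ℓ' J) = μ.law (A ∘L finiteCoords ℓ' J) := by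
    rw [← μ.map_law, ← hν' J, Measure.map_map (by fun_prop) (by fun_prop)]
    rfl
  have hνν' : ν' = ν := by
    refine eq_of_map_finiteCoords_eq hℓ fun J => ?_
    rw [hν J]
    exact key (J.map Function.Embedding.some) (ContinuousLinearMap.pi fun j : J =>
      ContinuousLinearMap.proj
        (⟨some j, Finset.mem_map_of_mem _ j.2⟩ : J.map Function.Embedding.some))
  rw [← hνν']
  exact key {none} (ContinuousLinearMap.proj
    (⟨none, Finset.mem_singleton_self none⟩ : ({none} : Finset (Option ℕ))))

/-! ### Existence of the Radon extension -/

lemma exists_measure_map_proj_eq (hX : IsReflexiveSpace X)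
    (hμ : ∀ N, IsProbabilityMeasure (μ.marginal N)) {p : ℝ} (hp : 0 < p)
    (hfin : μ.lintegral (fun x => ‖x‖ₑ ^ p) < ∞) :
    ∃ ν : Measure X, IsProbabilityMeasure ν ∧ ∀ N, ν.map N.proj = μ.marginal N := by
  -- Markov's inequality says nothing at `n = 0`, where the total mass serves as the bound.
  let u : ℕ → ℝ≥0 := fun n => if n = 0 then 1 else
    (μ.lintegral (fun x => ‖x‖ₑ ^ p)).toNNReal / (n : ℝ≥0) ^ p
  have hu0 : Tendsto u atTop (𝓝 0) := by
    have : Tendsto (fun n : ℕ => (μ.lintegral (fun x => ‖x‖ₑ ^ p)).toNNReal / (n : ℝ≥0) ^ p)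
        atTop (𝓝 0) := by
      rw [← NNReal.tendsto_coe]
      push_cast
      exact tendsto_const_nhds.div_atTop ((tendsto_rpow_atTop hp).comp tendsto_natCast_atTop_atTop)
    refine this.congr' ?_
    filter_upwards [eventually_ne_atTop 0] with n hn
    simp [u, hn]
  have hu (n : ℕ) (N : FinCodimSubspace X) : μ.marginal N {y | (n : ℝ) < ‖y‖} ≤ u n := by
    by_cases hn : n = 0
    · simpa [u, hn] using prob_le_one (μ := μ.marginal N)
    · have hn' : (0 : ℝ≥0) < n := by positivity
      have h := μ.marginal_norm_gt_le hp hn' N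
      simp only [u, hn, if_false]
      rw [ENNReal.coe_div (NNReal.rpow_pos hn').ne', ENNReal.coe_toNNReal hfin.ne,
        ENNReal.coe_rpow_of_nonneg _ hp.le]
      exact h
  obtain ⟨ν, hν1, hν⟩ := exists_measure_map_eq_law hX hμ hu0 hu
  refine ⟨ν, hν1, fun N => ?_⟩
  have : IsProbabilityMeasure (ν.map N.proj) :=
    Measure.isProbabilityMeasure_map N.projL.continuous.aemeasurable
  refine Measure.ext_of_charFunDual (funext fun g => ?_)
  change charFunDual (ν.map N.projL) g = charFunDual (μ.marginal N) g
  rw [charFunDual_eq_charFun_map_one, charFunDual_eq_charFun_map_one, map_marginal, ← hν,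
    Measure.map_map g.continuous.measurable N.projL.continuous.measurable]
  rfl

end CylinderMeasure

end

theorem mainTheorem2 {X : Type*} [NormedAddCommGroup X] [NormedSpace ℝ X] [CompleteSpace X]
    [TopologicalSpace.SeparableSpace X] [MeasurableSpace X] [BorelSpace X]
    (hX : IsReflexiveSpace X) (μ : CylinderMeasure X) (hμ : μ.IsGaussian)
    (p : ℝ) (hp : 0 < p) :
    μ.HasRadonExtension ↔ μ.lintegral (fun x => ‖x‖ₑ ^ p) < ∞ := by
  have : SecondCountableTopology X := UniformSpace.secondCountable_of_separable X
  constructor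
  · rintro ⟨ν, -, hν⟩
    have := CylinderMeasure.isGaussian_of_map_proj_eq hμ hν
    have hmem := (IsGaussian.memLp_id ν (ENNReal.ofReal p) ENNReal.ofReal_ne_top).eLpNorm_lt_top
    refine (CylinderMeasure.lintegral_le_of_map_proj_eq hν _).trans_lt ?_
    have h := lintegral_rpow_enorm_lt_top_of_eLpNorm_lt_top (by simpa using hp)
      ENNReal.ofReal_ne_top hmem
    simpa [ENNReal.toReal_ofReal hp.le] using h
  · intro h
    have hprob (N : FinCodimSubspace X) : IsProbabilityMeasure (μ.marginal N) :=
      have := hμ N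
      inferInstance
    obtain ⟨ν, hν1, hν⟩ := CylinderMeasure.exists_measure_map_proj_eq hX hprob hp h
    exact ⟨ν, ⟨inferInstance, inferInstance⟩, hν⟩
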